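/- All finite graphs are simple with vertex set $[n]=\{1,\dots,n\}$, $n\ge 1$ (labelled graphs, forming the set $\mathcal L$); let $\mathcal U=\mathcal L/\!\cong$ be the set of finite unlabelled graphs, and let $v(G)$ denote the number of vertices of $G$. For $F,G\in\mathcal U$ let $t(F,G)\in[0,1]$ be the proportion of graph homomorphisms $F\to G$ among all maps $V(F)\to V(G)$. Put $\tau(G)=(t(F,G))_{F\in\mathcal U}\in[0,1]^{\mathcal U}$ and $\tau^+(G)=(\tau(G),v(G)^{-1})\in[0,1]^{\mathcal U}\times[0,1]$, with product topologies. Identify $\mathcal U$ with its image under the injective map $\tau^+$, let $\overline{\mathcal U}$ be the closure of $\tau^+(\mathcal U)$, and let $\mathcal U_\infty=\overline{\mathcal U}\setminus\mathcal U$ be the set of proper graph limits. For each $F$, extend $t(F,\cdot)$ continuously to $\overline{\mathcal U}$. Let $\overline{\mathcal U^*}$ be the closure of $\tau(\mathcal U)$ in $[0,1]^{\mathcal U}$. Let $\mathcal L_\infty$ be the space of (simple) graphs with vertex set $\mathbb N=\{1,2,\dots\}$, identified with $\{0,1\}^{E(K_\infty)}$ with the product topology and its Borel $\sigma$-field. For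 $H\in\mathcal L_\infty$ let $H|_n$ be the induced subgraph on $[n]$, and for $F\in\mathcal L$ write $H\supset F$ if every edge of $F$ is an edge of $H$. A random $H\in\mathcal L_\infty$ is exchangeable if its distribution is invariant under every permutation of $\mathbb N$. **Corollary.** There is a one-to-one correspondence between the elements $\Gamma$ of $\mathcal U_\infty$ and the extreme points of the (convex) set of distributions of exchangeable random infinite graphs $H\in\mathcal L_\infty$. Here $\Gamma$ corresponds to the distribution of $H$ if and only if $$t(F,\Gamma)=\mathbb P(H\supset F)\qquad\text{for every } F\in\mathcal L .$$ Furthermore, if the distribution of $H$ is the extreme point corresponding to $\Gamma$, then $H|_n\to\Gamma$ almost surely in $\overline{\mathcal U}$ as $n\to\infty$. Finally, $\mathcal U_\infty\cong\overline{\mathcal U^*}$: the projection $[0,1]^{\mathcal U}\times[0,1]\to[0,1]^{\mathcal U}$ restricts to a homeomorphism of $\mathcal U_\infty$ onto $\overline{\mathcal U^*}$, so the same correspondence holds with the elements of $\overline{\mathcal U^*}$. -/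

import Mathlib

open Filter Topology MeasureTheory
open scoped NNReal

namespace GraphLimits

/-- Finite labelled (simple) graphs, with vertex set `{0, …, n - 1}` for some `n ≥ 1`. -/
abbrev Labelled : Type := Σ n : ℕ+, SimpleGraph (Fin n)

/-- Two labelled graphs are equivalent when they are isomorphic. -/
instance labelledSetoid : Setoid Labelled where
  r F G := Nonempty (F.2 ≃g G.2)
  iseqv :=
    { refl := fun _ => ⟨SimpleGraph.Iso.refl⟩
      symm := fun ⟨e⟩ => ⟨e.symm⟩
      trans := fun ⟨e⟩ ⟨f⟩ => ⟨e.trans f⟩ }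

/-- Finite unlabelled graphs: labelled graphs modulo isomorphism. -/
abbrev Unlabelled : Type := Quotient labelledSetoid

/-- The unlabelled graph underlying a labelled graph. -/
abbrev Labelled.toUnlabelled (G : Labelled) : Unlabelled := Quotient.mk labelledSetoid G

lemma order_eq_of_equiv {F G : Labelled} (h : F ≈ G) : F.1 = G.1 := by
  obtain ⟨e⟩ := h
  exact PNat.coe_injective (by simpa using Fintype.card_congr e.toEquiv)

/-- The number of vertices of an unlabelled graph. -/
def order : Unlabelled → ℕ+ :=
  Quotient.lift (fun G : Labelled => G.1) (fun _ _ h => order_eq_of_equiv h)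

/-- The proportion, among all maps `V(F) → V(G)`, of those that are graph homomorphisms. -/
noncomputable def homDensityReal (F G : Labelled) : ℝ :=
  (Nat.card (F.2 →g G.2) : ℝ) / (G.1 : ℝ) ^ (F.1 : ℕ)

lemma homDensityReal_mem (F G : Labelled) : homDensityReal F G ∈ unitInterval := by
  have h : Nat.card (F.2 →g G.2) ≤ (G.1 : ℕ) ^ (F.1 : ℕ) := by
    have := Nat.card_le_card_of_injective
      (fun f : F.2 →g G.2 => (f : Fin F.1 → Fin G.1)) DFunLike.coe_injective
    simpa using this
  refine ⟨by unfold homDensityReal; positivity, ?_⟩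
  unfold homDensityReal
  refine div_le_one_of_le₀ ?_ (by positivity)
  exact_mod_cast h

lemma homDensityReal_congr {F F' G G' : Labelled} (hF : F ≈ F') (hG : G ≈ G') :
    homDensityReal F G = homDensityReal F' G' := by
  have h₁ := order_eq_of_equiv hF
  have h₂ := order_eq_of_equiv hG
  obtain ⟨e⟩ := hF
  obtain ⟨f⟩ := hG
  have h : Nat.card (F.2 →g G.2) = Nat.card (F'.2 →g G'.2) :=
    Nat.card_congr
      { toFun := fun φ => (f.toHom.comp φ).comp e.symm.toHom
        invFun := fun φ => (f.symm.toHom.comp φ).comp e.toHom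
        left_inv := fun φ => by ext x; simp
        right_inv := fun φ => by ext x; simp }
  unfold homDensityReal
  rw [h, h₁, h₂]

/-- The homomorphism density `t(F, G)` of unlabelled graphs, with values in `[0, 1]`. -/
noncomputable def t (F G : Unlabelled) : unitInterval :=
  Quotient.lift₂ (fun F G : Labelled => (⟨homDensityReal F G, homDensityReal_mem F G⟩ : unitInterval))
    (fun _ _ _ _ hF hG => Subtype.ext (homDensityReal_congr hF hG)) F G

/-- `v(G)⁻¹`, the reciprocal of the number of vertices. -/
noncomputable def invOrder (G : Unlabelled) : unitInterval :=
  ⟨((order G : ℕ) : ℝ)⁻¹, by positivity,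
    inv_le_one_of_one_le₀ (by exact_mod_cast (order G).pos)⟩

/-- `τ(G) = (t(F, G))_F` in `[0, 1]^𝓤`, which carries the product topology. -/
noncomputable def tau (G : Unlabelled) : Unlabelled → unitInterval := fun F => t F G

/-- `τ⁺(G) = (τ(G), v(G)⁻¹)` in `[0, 1]^𝓤 × [0, 1]`. -/
noncomputable def tauPlus (G : Unlabelled) : (Unlabelled → unitInterval) × unitInterval :=
  (tau G, invOrder G)

/-- The compactification of the set `𝓤` of finite unlabelled graphs: the closure of the image
of the embedding `τ⁺`. -/
def UBar : Set ((Unlabelled → unitInterval) × unitInterval) := closure (Set.range tauPlus)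

/-- The set `𝓤_∞` of proper graph limits: the points of the compactification
that are not finite graphs. -/
def UInfty : Set ((Unlabelled → unitInterval) × unitInterval) := UBar \ Set.range tauPlus

/-- `t(F, Γ)` for a point `Γ` of the compactification. The coordinate projection is continuous
and agrees with `t F G` at `τ⁺(G)`, so it is the unique continuous extension of `t F`. -/
def tExt (F : Unlabelled) (Γ : (Unlabelled → unitInterval) × unitInterval) : ℝ := (Γ.1 F : ℝ)

/-- The closure of `τ(𝓤)` in `[0, 1]^𝓤`. -/
def UStarBar : Set (Unlabelled → unitInterval) := closure (Set.range tau)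

/-- The induced subgraph of an infinite graph on its first `n` vertices. -/
def restrict (H : SimpleGraph ℕ) (n : ℕ+) : Labelled := ⟨n, H.comap (Fin.val : Fin n → ℕ)⟩

/-- The event `H ⊇ F`: the infinite graph `H` contains every edge of `F`, where `F` is regarded
as an infinite graph by adding isolated vertices. -/
def containing (F : Labelled) : Set (SimpleGraph ℕ) :=
  {H | F.2.map Fin.valEmbedding ≤ H}

/-- The set of distributions of exchangeable random infinite graphs: the probability measures on
the space of graphs on `ℕ` that are invariant under every permutation of the vertices. The
σ-algebra is the one generated by the events `H.Adj i j`, that is, the Borel σ-algebra of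
the product topology on `{0, 1}^E(K_∞)`. -/
def exchangeableLaws : Set (Measure (SimpleGraph ℕ)) :=
  {μ | IsProbabilityMeasure μ ∧
    ∀ σ : Equiv.Perm ℕ, MeasurePreserving (fun H : SimpleGraph ℕ => H.map σ.toEmbedding) μ μ}

end GraphLimits

/-!
The correspondence rests on one property of an exchangeable law `μ`: for each finite graph `F`,
two disjoint copies of `F` are contained in `H` with probability `μ(H ⊇ F) ^ 2`.

* Extreme laws have it (`real_containing_double_of_extreme`). Condition on `H ⊇ F` or on its
  complement and delete the vertices of `F`: both conditional laws are exchangeable, and `μ` is a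
  mixture of them, so by extremality conditioning changes nothing.
* It forces a law of large numbers (`ae_tendsto_homCount_div`). The second moment of
  `t(F, H|_n) - μ(H ⊇ F)` is an average over pairs of maps `V(F) → [n]`. The jointly injective
  pairs contribute zero, and only a fraction `O(1 / n)` of the pairs is not jointly injective.
  Borel–Cantelli along squares and monotonicity of the number of homomorphisms give almost sure
  convergence.
* Conversely it implies extremality (`mem_extremePoints_of_real_containing_double`): a component of
  a mixture is absolutely continuous with respect to `μ`, hence sees the same constant limit
  densities, and their expectations determine the law.

In one direction, an extreme law yields a limit: `H|_n` converges almost surely, so some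
realisation exhibits the point `(μ(H ⊇ F))_F` with second coordinate `0` as a limit of finite
graphs. In the other direction, sampling the vertices of a finite graph `G` with replacement gives
random arrays with containment probabilities `t(F, G)`; compactness of the space of laws extends
this to all limits (`exists_mem_exchangeableLaws`), and
`t(F ⊔ F, G) = t(F, G) ^ 2` passes to the limit, so the resulting law is extreme.

Finally `𝓤_∞` is exactly the closure of `τ(𝓤)` times `{0}` (`mem_UInfty_iff`): only finitely many
graphs have bounded order, and every point of the closure of `τ(𝓤)` is a limit of the
graphs `H|_n`, whose orders tend to infinity.
-/

namespace GraphLimits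

/-! ### Homomorphism events and exchangeability -/

/-- The event that `f : V → ℕ` is a graph homomorphism from `F` to the random infinite graph.
The map `f` need not be injective. -/
def homEvent {V : Type*} (F : SimpleGraph V) (f : V → ℕ) : Set (SimpleGraph ℕ) :=
  {H | ∀ i j, F.Adj i j → H.Adj (f i) (f j)}

lemma measurableSet_homEvent {V : Type*} [Countable V] (F : SimpleGraph V) (f : V → ℕ) :
    MeasurableSet (homEvent F f) := by
  have : homEvent F f = ⋂ i, ⋂ j, ⋂ (_ : F.Adj i j), {H | H.Adj (f i) (f j)} := by
    ext H; simp [homEvent]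
  rw [this]
  refine .iInter fun i => .iInter fun j => .iInter fun _ => ?_
  exact measurableSet_setOfPred.2 (SimpleGraph.measurable_iff_adj.1 measurable_id _ _)

lemma containing_eq_homEvent (F : Labelled) : containing F = homEvent F.2 Fin.val := by
  ext H
  simp only [containing, homEvent, Set.mem_ofPred_eq, SimpleGraph.map_le_iff_le_comap]
  exact ⟨fun h i j hij => h hij, fun h i j hij => h i j hij⟩

lemma measurableSet_containing (F : Labelled) : MeasurableSet (containing F) :=
  containing_eq_homEvent F ▸ measurableSet_homEvent _ _

lemma homEvent_sum {V W : Type*} (F : SimpleGraph V) (G : SimpleGraph W) (f : V → ℕ)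
    (g : W → ℕ) : homEvent (F ⊕g G) (Sum.elim f g) = homEvent F f ∩ homEvent G g := by
  ext H
  simp [homEvent]

lemma homEvent_comap_comp_equiv {V W : Type*} (F : SimpleGraph V) (e : W ≃ V) (f : V → ℕ) :
    homEvent (F.comap e) (f ∘ e) = homEvent F f := by
  ext H
  simp only [homEvent, Set.mem_ofPred_eq, SimpleGraph.comap_adj, Function.comp]
  exact ⟨fun h i j hij => by simpa using h (e.symm i) (e.symm j) (by simpa using hij),
    fun h i j => h _ _⟩

lemma preimage_map_homEvent {V : Type*} (F : SimpleGraph V) (f : V → ℕ) (σ : Equiv.Perm ℕ) :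
    (fun H : SimpleGraph ℕ => H.map σ.toEmbedding) ⁻¹' homEvent F f
      = homEvent F (σ.symm ∘ f) := by
  ext H
  simp only [homEvent, Set.mem_preimage, Set.mem_ofPred_eq, ← SimpleGraph.comap_symm,
    SimpleGraph.comap_adj, Function.comp]
  rfl

lemma measurable_map_perm (σ : Equiv.Perm ℕ) :
    Measurable (fun H : SimpleGraph ℕ => H.map σ.toEmbedding) := by
  rw [SimpleGraph.measurable_iff_adj]
  intro u v
  simp only [← SimpleGraph.comap_symm, SimpleGraph.comap_adj]
  exact SimpleGraph.measurable_iff_adj.1 measurable_id _ _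

lemma measurable_comap (s : ℕ → ℕ) : Measurable (fun H : SimpleGraph ℕ => H.comap s) := by
  rw [SimpleGraph.measurable_iff_adj]
  intro u v
  simp only [SimpleGraph.comap_adj]
  exact SimpleGraph.measurable_iff_adj.1 measurable_id _ _

lemma preimage_comap_homEvent {V : Type*} (F : SimpleGraph V) (f : V → ℕ) (s : ℕ → ℕ) :
    (fun H : SimpleGraph ℕ => H.comap s) ⁻¹' homEvent F f = homEvent F (s ∘ f) := by
  ext H
  simp [homEvent]

/-- A graph on `ℕ` with all edges inside `{0, …, n - 1}` is a finite graph plus isolated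
vertices. -/
lemma setOf_le_eq_containing (A : SimpleGraph ℕ) (n : ℕ+)
    (hA : ∀ i j, A.Adj i j → i < n) : {H | A ≤ H} = containing (restrict A n) := by
  rw [containing_eq_homEvent]
  ext H
  simp only [homEvent, restrict, Set.mem_ofPred_eq, SimpleGraph.comap_adj]
  exact ⟨fun h i j hij => h hij,
    fun h i j hij => h ⟨i, hA i j hij⟩ ⟨j, hA j i hij.symm⟩ hij⟩

lemma isPiSystem_containing : IsPiSystem (Set.range containing) := by
  rintro _ ⟨F, rfl⟩ _ ⟨G, rfl⟩ -
  refine ⟨restrict (F.2.map Fin.valEmbedding ⊔ G.2.map Fin.valEmbedding) (F.1 + G.1), ?_⟩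
  rw [← setOf_le_eq_containing]
  · ext H; simp [containing]
  · rintro i j (h | h) <;>
    · rw [SimpleGraph.map_adj] at h
      obtain ⟨a, b, -, rfl, -⟩ := h
      have := a.2
      simp
      omega

lemma generateFrom_containing :
    (inferInstance : MeasurableSpace (SimpleGraph ℕ))
      = MeasurableSpace.generateFrom (Set.range containing) := by
  apply le_antisymm
  · have h : @Measurable _ _ (MeasurableSpace.generateFrom (Set.range containing)) _
        (SimpleGraph.Adj : SimpleGraph ℕ → ℕ → ℕ → Prop) := by
      refine @measurable_pi_lambda _ _ _ (_) _ _ fun u => ?_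
      refine @measurable_pi_lambda _ _ _ (_) _ _ fun v => ?_
      refine (@measurableSet_setOfPred _ (_) _).1 ?_
      by_cases huv : u = v
      · subst huv
        simp
      · apply MeasurableSpace.measurableSet_generateFrom
        refine ⟨restrict (SimpleGraph.edge u v) (Nat.succPNat (u + v)), ?_⟩
        rw [← setOf_le_eq_containing]
        · ext H
          simp [huv]
        · intro i j h
          rw [SimpleGraph.edge_adj] at h
          rw [Nat.succPNat_coe]
          omega
    exact h.comap_le
  · refine MeasurableSpace.generateFrom_le ?_
    rintro _ ⟨F, rfl⟩
    exact measurableSet_containing F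

/-- The law of a random infinite graph is determined by the probabilities `ℙ(H ⊇ F)`. -/
lemma measure_ext_of_containing {μ ν : Measure (SimpleGraph ℕ)} [IsProbabilityMeasure μ]
    [IsProbabilityMeasure ν] (h : ∀ F, μ.real (containing F) = ν.real (containing F)) :
    μ = ν := by
  refine ext_of_generate_finite _ generateFrom_containing isPiSystem_containing ?_ (by simp)
  rintro _ ⟨F, rfl⟩
  exact (measureReal_eq_measureReal_iff).1 (h F)

lemma exists_perm_comp_eq {n : ℕ} {f g : Fin n → ℕ} (hf : f.Injective) (hg : g.Injective) :
    ∃ σ : Equiv.Perm ℕ, σ ∘ f = g := by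
  obtain ⟨σ, hσ⟩ := (Equiv.Perm.isMultiplyPretransitive ℕ n).exists_smul_eq ⟨f, hf⟩ ⟨g, hg⟩
  exact ⟨σ, funext fun i => DFunLike.congr_fun hσ i⟩

lemma real_homEvent_of_injective {μ : Measure (SimpleGraph ℕ)} (hμ : μ ∈ exchangeableLaws)
    (F : Labelled) {f : Fin F.1 → ℕ} (hf : f.Injective) :
    μ.real (homEvent F.2 f) = μ.real (containing F) := by
  obtain ⟨σ, hσ⟩ := exists_perm_comp_eq hf Fin.val_injective
  have h := (hμ.2 σ.symm).measure_preimage (measurableSet_homEvent F.2 f).nullMeasurableSet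
  rw [preimage_map_homEvent, Equiv.symm_symm, hσ] at h
  rw [Measure.real, Measure.real, containing_eq_homEvent, h]

/-- Exchangeability, expressed through the events `H ⊇ F` for relabelled finite graphs `F`. -/
lemma mem_exchangeableLaws_of_homEvent {μ : Measure (SimpleGraph ℕ)} [IsProbabilityMeasure μ]
    (h : ∀ (F : Labelled) (f : Fin F.1 → ℕ), f.Injective →
      μ.real (homEvent F.2 f) = μ.real (containing F)) : μ ∈ exchangeableLaws := by
  refine ⟨inferInstance, fun σ => ⟨measurable_map_perm σ, ?_⟩⟩
  have := Measure.isProbabilityMeasure_map (μ := μ) (measurable_map_perm σ).aemeasurable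
  refine measure_ext_of_containing fun F => ?_
  rw [map_measureReal_apply (measurable_map_perm σ) (measurableSet_containing F),
    containing_eq_homEvent, preimage_map_homEvent, h F _ (σ.symm.injective.comp
      Fin.val_injective), containing_eq_homEvent]

/-- An exchangeable law does not change when vertices are dropped and relabelled injectively. -/
lemma map_comap_eq_self {μ : Measure (SimpleGraph ℕ)} (hμ : μ ∈ exchangeableLaws) {s : ℕ → ℕ}
    (hs : s.Injective) : μ.map (fun H => H.comap s) = μ := by
  have := hμ.1
  have := Measure.isProbabilityMeasure_map (μ := μ) (measurable_comap s).aemeasurable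
  refine measure_ext_of_containing fun F => ?_
  rw [map_measureReal_apply (measurable_comap s) (measurableSet_containing F),
    containing_eq_homEvent, preimage_comap_homEvent,
    real_homEvent_of_injective hμ F (hs.comp Fin.val_injective), containing_eq_homEvent]

/-- Two disjoint copies of a finite graph. -/
def Labelled.double (F : Labelled) : Labelled :=
  ⟨F.1 + F.1, (F.2 ⊕g F.2).comap (finSumFinEquiv (m := F.1) (n := F.1)).symm⟩

lemma real_homEvent_inter {μ : Measure (SimpleGraph ℕ)} (hμ : μ ∈ exchangeableLaws)
    (F : Labelled) {f g : Fin F.1 → ℕ} (h : (Sum.elim f g).Injective) :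
    μ.real (homEvent F.2 f ∩ homEvent F.2 g) = μ.real (containing F.double) := by
  rw [← homEvent_sum, ← homEvent_comap_comp_equiv _ finSumFinEquiv.symm]
  exact real_homEvent_of_injective hμ F.double (h.comp finSumFinEquiv.symm.injective)

/-! ### A law of large numbers for homomorphism densities -/

/-- The functions from `V` to `{0, …, n - 1}`, as functions to `ℕ`. -/
def box (V : Type*) [Fintype V] [DecidableEq V] (n : ℕ) : Finset (V → ℕ) :=
  Fintype.piFinset fun _ => Finset.range n

lemma mem_box {V : Type*} [Fintype V] [DecidableEq V] {n : ℕ} {f : V → ℕ} :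
    f ∈ box V n ↔ ∀ i, f i < n := by
  simp [box]

lemma card_box (V : Type*) [Fintype V] [DecidableEq V] (n : ℕ) :
    (box V n).card = n ^ Fintype.card V := by
  simp [box]

/-- A function into `{0, …, n - 1}` with `f i = f j` loses one degree of freedom. -/
lemma card_filter_eq_mul_le {V : Type*} [Fintype V] [DecidableEq V] (n : ℕ) {i j : V}
    (hij : i ≠ j) : ((box V n).filter fun f => f i = f j).card * n ≤ (box V n).card := by
  rw [← Finset.card_range n, ← Finset.card_product, Finset.card_range]
  refine Finset.card_le_card_of_injOn (fun p => Function.update p.1 j p.2) ?_ ?_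
  · rintro ⟨f, a⟩ h
    simp only [Finset.coe_product, Set.mem_prod, Finset.mem_coe, Finset.mem_filter,
      Finset.mem_range, mem_box] at h ⊢
    intro l
    by_cases hl : l = j
    · subst hl; simpa using h.2
    · simpa [hl] using h.1.1 l
  · rintro ⟨f, a⟩ hf ⟨g, b⟩ hg h
    simp only [Finset.coe_product, Set.mem_prod, Finset.mem_coe, Finset.mem_filter] at hf hg h
    have key : ∀ l, l ≠ j → f l = g l := fun l hl => by
      simpa [hl] using congrFun h l
    have hab : a = b := by simpa using congrFun h j
    refine Prod.ext (funext fun l => ?_) hab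
    by_cases hl : l = j
    · subst hl
      change f l = g l
      rw [← hf.1.2, ← hg.1.2]
      exact key i hij
    · exact key l hl

lemma card_filter_not_injective_mul_le (V : Type*) [Fintype V] [DecidableEq V] (n : ℕ)
    [DecidablePred fun f : V → ℕ => ¬ f.Injective] :
    ((box V n).filter fun f => ¬ f.Injective).card * n
      ≤ Fintype.card V ^ 2 * n ^ Fintype.card V := by
  have hsub : ((box V n).filter fun f => ¬ f.Injective) ⊆
      (Finset.univ.filter fun p : V × V => p.1 ≠ p.2).biUnion
        fun p => (box V n).filter fun f => f p.1 = f p.2 := by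
    intro f hf
    simp only [Finset.mem_filter, Function.Injective, not_forall] at hf
    obtain ⟨hf, i, j, hfij, hij⟩ := hf
    simp only [Finset.mem_biUnion, Finset.mem_filter, Finset.mem_univ, true_and]
    exact ⟨(i, j), hij, hf, hfij⟩
  calc _ ≤ (∑ p ∈ Finset.univ.filter fun p : V × V => p.1 ≠ p.2,
          ((box V n).filter fun f => f p.1 = f p.2).card) * n :=
        Nat.mul_le_mul_right _ ((Finset.card_le_card hsub).trans Finset.card_biUnion_le)
    _ ≤ ∑ p ∈ Finset.univ.filter fun p : V × V => p.1 ≠ p.2, n ^ Fintype.card V := by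
        rw [Finset.sum_mul]
        refine Finset.sum_le_sum fun p hp => ?_
        rw [← card_box]
        exact card_filter_eq_mul_le n (Finset.mem_filter.1 hp).2
    _ ≤ ∑ _p : V × V, n ^ Fintype.card V :=
        Finset.sum_le_sum_of_subset (Finset.filter_subset _ _)
    _ = _ := by simp [sq]

/-- The average over all functions `V → {0, …, n - 1}` of a bounded quantity that vanishes on
injective functions is `O(1 / n)`. -/
lemma abs_sum_box_div_le {V : Type*} [Fintype V] [DecidableEq V] {n : ℕ} (hn : 0 < n)
    (g : (V → ℕ) → ℝ) (hg : ∀ f, |g f| ≤ 1) (hg0 : ∀ f, f.Injective → g f = 0) :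
    |(∑ f ∈ box V n, g f) / (n : ℝ) ^ Fintype.card V| ≤ (Fintype.card V : ℝ) ^ 2 / n := by
  classical
  have h1 : |∑ f ∈ box V n, g f| ≤ ((box V n).filter fun f => ¬ f.Injective).card := by
    rw [← Finset.sum_filter_add_sum_filter_not (box V n) (fun f => f.Injective),
      Finset.sum_eq_zero (fun f hf => hg0 f (Finset.mem_filter.1 hf).2), zero_add]
    refine (Finset.abs_sum_le_sum_abs _ _).trans ?_
    refine (Finset.sum_le_sum fun f _ => hg f).trans ?_
    simp
  have h2 : (((box V n).filter fun f => ¬ f.Injective).card : ℝ) * n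
      ≤ (Fintype.card V : ℝ) ^ 2 * (n : ℝ) ^ Fintype.card V := by
    exact_mod_cast card_filter_not_injective_mul_le V n
  have hn' : (0 : ℝ) < n := by exact_mod_cast hn
  rw [abs_div, abs_of_pos (by positivity : (0 : ℝ) < (n : ℝ) ^ Fintype.card V),
    div_le_div_iff₀ (by positivity) hn']
  exact (mul_le_mul_of_nonneg_right h1 hn'.le).trans h2

/-- The number of homomorphisms from `F` into the induced subgraph of `H` on its first `n`
vertices. -/
noncomputable def homCount (F : Labelled) (n : ℕ) (H : SimpleGraph ℕ) : ℝ :=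
  ∑ f ∈ box (Fin F.1) n, (homEvent F.2 f).indicator 1 H

lemma homDensityReal_restrict (F : Labelled) (n : ℕ+) (H : SimpleGraph ℕ) :
    homDensityReal F (restrict H n) = homCount F n H / ((n : ℕ) : ℝ) ^ (F.1 : ℕ) := by
  classical
  have : Nat.card (F.2 →g (restrict H n).2)
      = ((box (Fin F.1) n).filter fun f => H ∈ homEvent F.2 f).card := by
    rw [← Nat.card_eq_finsetCard]
    exact Nat.card_congr
      { toFun := fun φ => ⟨fun i => (φ i : Fin n), Finset.mem_filter.2
          ⟨mem_box.2 fun i => (φ i : Fin n).2, fun i j hij => φ.map_adj hij⟩⟩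
        invFun := fun f =>
          { toFun := fun i => ⟨f.1 i, mem_box.1 (Finset.mem_filter.1 f.2).1 i⟩
            map_rel' := fun {i j} hij => (Finset.mem_filter.1 f.2).2 i j hij }
        left_inv := fun φ => rfl
        right_inv := fun f => rfl }
  rw [homDensityReal, this, homCount, Finset.card_filter]
  simp [Set.indicator_apply, restrict]

lemma homCount_mono (F : Labelled) (H : SimpleGraph ℕ) : Monotone fun n => homCount F n H := by
  intro m n hmn
  refine Finset.sum_le_sum_of_subset_of_nonneg (fun f hf => ?_) fun f _ _ =>
    Set.indicator_nonneg (by simp) _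
  exact mem_box.2 fun i => (mem_box.1 hf i).trans_le hmn

lemma homCount_nonneg (F : Labelled) (n : ℕ) (H : SimpleGraph ℕ) : 0 ≤ homCount F n H :=
  Finset.sum_nonneg fun f _ => Set.indicator_nonneg (by simp) _

lemma homCount_div_mem_unitInterval (F : Labelled) (n : ℕ) (H : SimpleGraph ℕ) :
    homCount F n H / (n : ℝ) ^ (F.1 : ℕ) ∈ unitInterval := by
  refine ⟨div_nonneg (homCount_nonneg F n H) (by positivity), div_le_one_of_le₀ ?_
    (by positivity)⟩
  have h : homCount F n H ≤ (box (Fin F.1) n).card • (1 : ℝ) :=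
    Finset.sum_le_card_nsmul _ _ _ fun f _ => Set.indicator_le_self' (by simp) H
  rw [card_box, Fintype.card_fin] at h
  simpa using h

lemma measurable_homCount (F : Labelled) (n : ℕ) : Measurable (homCount F n) :=
  Finset.measurable_sum _ fun f _ =>
    (measurable_one.indicator (measurableSet_homEvent F.2 f))

lemma integrable_indicator_homEvent {μ : Measure (SimpleGraph ℕ)} [IsProbabilityMeasure μ]
    (F : Labelled) (f : Fin F.1 → ℕ) :
    Integrable ((homEvent F.2 f).indicator (1 : SimpleGraph ℕ → ℝ)) μ :=
  (integrable_const (1 : ℝ)).indicator (measurableSet_homEvent F.2 f)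

/-- Under an exchangeable law, the expected homomorphism density converges to the probability of
containing `F`. -/
lemma tendsto_integral_homCount_div {μ : Measure (SimpleGraph ℕ)} (hμ : μ ∈ exchangeableLaws)
    (F : Labelled) :
    Tendsto (fun n : ℕ => ∫ H, homCount F n H / (n : ℝ) ^ (F.1 : ℕ) ∂μ) atTop
      (𝓝 (μ.real (containing F))) := by
  have := hμ.1
  set a := μ.real (containing F) with ha
  rw [← tendsto_sub_nhds_zero_iff]
  refine squeeze_zero_norm' (a := fun n : ℕ => ((F.1 : ℕ) : ℝ) ^ 2 / n) ?_
    (tendsto_const_div_atTop_nhds_zero_nat _)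
  filter_upwards [eventually_gt_atTop 0] with n hn
  have hn' : (n : ℝ) ^ (F.1 : ℕ) ≠ 0 := by positivity
  have h := abs_sum_box_div_le hn (fun f : Fin F.1 → ℕ => μ.real (homEvent F.2 f) - a)
    (fun f => by
      have h1 : μ.real (homEvent F.2 f) ≤ 1 := measureReal_le_one
      have h2 : a ≤ 1 := measureReal_le_one
      have h3 : 0 ≤ μ.real (homEvent F.2 f) := measureReal_nonneg
      have h4 : 0 ≤ a := measureReal_nonneg
      rw [abs_le]; constructor <;> linarith)
    (fun f hf => by rw [real_homEvent_of_injective hμ F hf, sub_self])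
  rw [Fintype.card_fin] at h
  convert h using 1
  rw [Real.norm_eq_abs, integral_div]
  congr 1
  unfold homCount
  rw [integral_finsetSum _ fun f _ => integrable_indicator_homEvent F f, Finset.sum_sub_distrib,
    Finset.sum_const, card_box, Fintype.card_fin, sub_div, nsmul_eq_mul]
  push_cast
  rw [mul_div_cancel_left₀ _ hn']
  congr 2
  exact Finset.sum_congr rfl fun f _ => integral_indicator_one (measurableSet_homEvent F.2 f)

/-- If the events that two disjoint copies of `F` are present are uncorrelated, then the
homomorphism density of `F` has second moment `O(1 / n)` around the probability of
containing `F`. -/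
lemma integral_homCount_sub_sq_le {μ : Measure (SimpleGraph ℕ)} (hμ : μ ∈ exchangeableLaws)
    (F : Labelled) (hF : μ.real (containing F.double) = μ.real (containing F) ^ 2) {n : ℕ}
    (hn : 0 < n) :
    ∫ H, (homCount F n H / (n : ℝ) ^ (F.1 : ℕ) - μ.real (containing F)) ^ 2 ∂μ
      ≤ (2 * (F.1 : ℕ) : ℝ) ^ 2 / n := by
  have := hμ.1
  set a := μ.real (containing F) with ha
  have ha0 : 0 ≤ a := measureReal_nonneg
  have ha1 : a ≤ 1 := measureReal_le_one
  have hn' : (n : ℝ) ^ (F.1 : ℕ) ≠ 0 := by positivity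
  set D : (Fin F.1 → ℕ) → SimpleGraph ℕ → ℝ :=
    fun f H => (homEvent F.2 f).indicator 1 H - a with hD
  have hDm : ∀ f, Measurable (D f) := fun f =>
    (measurable_one.indicator (measurableSet_homEvent F.2 f)).sub_const a
  have hDb : ∀ f H, |D f H| ≤ 1 := fun f H => by
    by_cases h : H ∈ homEvent F.2 f
    · simp only [hD, Set.indicator_of_mem h, Pi.one_apply, abs_le]
      constructor <;> linarith
    · simp only [hD, Set.indicator_of_notMem h, abs_le]
      constructor <;> linarith
  have hDDb : ∀ f g H, ‖D f H * D g H‖ ≤ 1 := fun f g H => by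
    rw [Real.norm_eq_abs, abs_mul]
    exact mul_le_one₀ (hDb f H) (abs_nonneg _) (hDb g H)
  have hDDi : ∀ f g, Integrable (fun H => D f H * D g H) μ := fun f g =>
    Integrable.of_bound ((hDm f).mul (hDm g)).aestronglyMeasurable 1
      (ae_of_all _ (hDDb f g))
  have hsq : ∀ H, (homCount F n H / (n : ℝ) ^ (F.1 : ℕ) - a) ^ 2
      = (∑ p ∈ box (Fin F.1 ⊕ Fin F.1) n, D (p ∘ Sum.inl) H * D (p ∘ Sum.inr) H)
        / (n : ℝ) ^ Fintype.card (Fin F.1 ⊕ Fin F.1) := by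
    intro H
    have h1 : homCount F n H / (n : ℝ) ^ (F.1 : ℕ) - a
        = (∑ f ∈ box (Fin F.1) n, D f H) / (n : ℝ) ^ (F.1 : ℕ) := by
      simp only [hD, Finset.sum_sub_distrib, Finset.sum_const, card_box, Fintype.card_fin,
        nsmul_eq_mul, sub_div, homCount]
      push_cast
      rw [mul_div_cancel_left₀ _ hn']
    have h2 : ∑ p ∈ box (Fin F.1 ⊕ Fin F.1) n, D (p ∘ Sum.inl) H * D (p ∘ Sum.inr) H
        = ∑ q ∈ box (Fin F.1) n ×ˢ box (Fin F.1) n, D q.1 H * D q.2 H := by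
      refine Finset.sum_equiv (Equiv.sumArrowEquivProdArrow _ _ _) (fun p => ?_) fun p _ => rfl
      simp [mem_box, Finset.mem_product]
    rw [h1, h2, div_pow, Fintype.card_sum, Fintype.card_fin, ← two_mul, mul_comm 2, pow_mul,
      sq (∑ f ∈ _, _), Finset.sum_mul_sum, Finset.sum_product]
  simp only [hsq]
  rw [integral_div, integral_finsetSum _ fun p _ => hDDi _ _]
  refine (le_abs_self _).trans ?_
  have h := abs_sum_box_div_le hn (fun p : Fin F.1 ⊕ Fin F.1 → ℕ =>
    ∫ H, D (p ∘ Sum.inl) H * D (p ∘ Sum.inr) H ∂μ) (fun p => ?_) fun p hp => ?_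
  · refine h.trans_eq ?_
    rw [Fintype.card_sum, Fintype.card_fin]
    push_cast
    ring
  · refine (norm_integral_le_of_norm_le_const (ae_of_all _ (hDDb _ _))).trans ?_
    simp
  · set f := p ∘ Sum.inl with hf
    set g := p ∘ Sum.inr with hg
    have hpfg : Sum.elim f g = p := Sum.elim_comp_inl_inr p
    have e : ∀ H, D f H * D g H = (homEvent F.2 f ∩ homEvent F.2 g).indicator 1 H
        - a * (homEvent F.2 f).indicator 1 H - a * (homEvent F.2 g).indicator 1 H + a ^ 2 := by
      intro H
      rw [Set.inter_indicator_one]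
      simp only [hD, Pi.mul_apply]
      ring
    have i1 : Integrable ((homEvent F.2 f ∩ homEvent F.2 g).indicator
        (1 : SimpleGraph ℕ → ℝ)) μ := (integrable_const (1 : ℝ)).indicator
      ((measurableSet_homEvent F.2 f).inter (measurableSet_homEvent F.2 g))
    have i2 := (integrable_indicator_homEvent (μ := μ) F f).const_mul a
    have i3 := (integrable_indicator_homEvent (μ := μ) F g).const_mul a
    have i12 : Integrable (fun H => (homEvent F.2 f ∩ homEvent F.2 g).indicator 1 H
        - a * (homEvent F.2 f).indicator 1 H) μ := i1.sub i2
    have i123 : Integrable (fun H => (homEvent F.2 f ∩ homEvent F.2 g).indicator 1 H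
        - a * (homEvent F.2 f).indicator 1 H - a * (homEvent F.2 g).indicator 1 H) μ :=
      i12.sub i3
    simp only [e]
    rw [integral_add i123 (integrable_const _), integral_sub i12 i3,
      integral_sub i1 i2, integral_const_mul, integral_const_mul,
      integral_indicator_one ((measurableSet_homEvent F.2 f).inter (measurableSet_homEvent F.2 g)),
      integral_indicator_one (measurableSet_homEvent F.2 f),
      integral_indicator_one (measurableSet_homEvent F.2 g),
      real_homEvent_inter hμ F (hpfg ▸ hp),
      real_homEvent_of_injective hμ F (hp.comp Sum.inl_injective),
      real_homEvent_of_injective hμ F (hp.comp Sum.inr_injective), hF, ← ha]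
    simp
    ring

/-- Nonnegative random variables with summable expectations converge to zero almost surely. -/
lemma ae_tendsto_zero_of_summable_integral {Ω : Type*} [MeasurableSpace Ω] {μ : Measure Ω}
    {X : ℕ → Ω → ℝ} (hX : ∀ m, Integrable (X m) μ) (h0 : ∀ m ω, 0 ≤ X m ω)
    (hs : Summable fun m => ∫ ω, X m ω ∂μ) :
    ∀ᵐ ω ∂μ, Tendsto (fun m => X m ω) atTop (𝓝 0) := by
  have hm : ∀ m, AEMeasurable (fun ω => ENNReal.ofReal (X m ω)) μ := fun m =>
    (hX m).aemeasurable.ennreal_ofReal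
  have hfin : ∫⁻ ω, ∑' m, ENNReal.ofReal (X m ω) ∂μ ≠ ⊤ := by
    rw [lintegral_tsum hm]
    simp only [← ofReal_integral_eq_lintegral_ofReal (hX _) (ae_of_all _ (h0 _))]
    exact hs.tsum_ofReal_ne_top
  filter_upwards [ae_lt_top' (AEMeasurable.tsum hm) hfin] with ω hω
  have := ENNReal.tendsto_atTop_zero_of_tsum_ne_top hω.ne
  have h := (ENNReal.tendsto_toReal ENNReal.zero_ne_top).comp this
  simpa [Function.comp_def, ENNReal.toReal_ofReal (h0 _ ω)] using h

/-- Law of large numbers for homomorphism densities: if the presences of two disjoint copies of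
`F` are uncorrelated events, the densities of `F` in `H|_n` converge almost surely. -/
lemma ae_tendsto_homCount_div {μ : Measure (SimpleGraph ℕ)} (hμ : μ ∈ exchangeableLaws)
    (F : Labelled) (hF : μ.real (containing F.double) = μ.real (containing F) ^ 2) :
    ∀ᵐ H ∂μ, Tendsto (fun n : ℕ => homCount F n H / (n : ℝ) ^ (F.1 : ℕ)) atTop
      (𝓝 (μ.real (containing F))) := by
  have := hμ.1
  set a := μ.real (containing F) with ha
  set k := (F.1 : ℕ) with hk
  have hk0 : k ≠ 0 := PNat.ne_zero F.1
  have hb : ∀ (n : ℕ) H, homCount F n H / (n : ℝ) ^ k ∈ unitInterval :=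
    homCount_div_mem_unitInterval F
  have ha0 : 0 ≤ a := measureReal_nonneg
  have ha1 : a ≤ 1 := measureReal_le_one
  -- Along the squares the second moments are summable.
  have hsub : ∀ᵐ H ∂μ, Tendsto (fun m : ℕ =>
      (homCount F ((m + 1) ^ 2) H / (((m + 1) ^ 2 : ℕ) : ℝ) ^ k - a) ^ 2) atTop (𝓝 0) := by
    refine ae_tendsto_zero_of_summable_integral (fun m => ?_) (fun m H => sq_nonneg _) ?_
    · refine Integrable.of_bound (C := 1) (((measurable_homCount F _).div_const _).sub_const _
        |>.pow_const 2).aestronglyMeasurable (ae_of_all _ fun H => ?_)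
      obtain ⟨h1, h2⟩ := hb ((m + 1) ^ 2) H
      rw [Real.norm_eq_abs, abs_of_nonneg (sq_nonneg _), sq_le_one_iff_abs_le_one, abs_le]
      constructor <;> linarith
    · refine Summable.of_nonneg_of_le (fun m => integral_nonneg fun H => sq_nonneg _)
        (fun m => integral_homCount_sub_sq_le hμ F hF (by positivity)) ?_
      have := ((summable_nat_add_iff 1).2
        (Real.summable_one_div_nat_pow (p := 2).2 (by norm_num))).mul_left ((2 * k : ℝ) ^ 2)
      refine this.congr fun m => ?_
      push_cast
      rw [mul_one_div]
  filter_upwards [hsub] with H hH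
  have hH' : Tendsto (fun m : ℕ => homCount F ((m + 1) ^ 2) H / (((m + 1) ^ 2 : ℕ) : ℝ) ^ k)
      atTop (𝓝 a) := by
    rw [← tendsto_sub_nhds_zero_iff, tendsto_zero_iff_abs_tendsto_zero]
    have := (Real.continuous_sqrt.tendsto 0).comp hH
    simpa [Function.comp_def, Real.sqrt_sq_eq_abs] using this
  -- The counts are monotone in `n`, so their `k`-th roots, which grow linearly, can be
  -- interpolated between squares.
  have hroot : ∀ n : ℕ, (homCount F n H) ^ (k⁻¹ : ℝ) / n
      = (homCount F n H / (n : ℝ) ^ k) ^ (k⁻¹ : ℝ) := fun n => by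
    rw [Real.div_rpow (homCount_nonneg F n H) (by positivity),
      Real.pow_rpow_inv_natCast (by positivity) hk0]
  have key : Tendsto (fun n : ℕ => (homCount F n H) ^ (k⁻¹ : ℝ) / n) atTop
      (𝓝 (a ^ (k⁻¹ : ℝ))) := by
    refine tendsto_div_of_monotone_of_exists_subseq_tendsto_div _ _ (fun m n hmn =>
      Real.rpow_le_rpow (homCount_nonneg F m H) (homCount_mono F H hmn) (by positivity))
      fun b hb => ⟨fun m => (m + 1) ^ 2, ?_, ?_, ?_⟩
    · have h1 : Tendsto (fun m : ℕ => (1 + 1 / ((m : ℝ) + 1)) ^ 2) atTop (𝓝 1) := by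
        have := (tendsto_one_div_add_atTop_nhds_zero_nat (𝕜 := ℝ)).const_add 1 |>.pow 2
        simpa using this
      filter_upwards [h1.eventually (gt_mem_nhds hb)] with m hm
      have : ((((m + 1 + 1) ^ 2 : ℕ)) : ℝ)
          = (1 + 1 / ((m : ℝ) + 1)) ^ 2 * (((m + 1) ^ 2 : ℕ) : ℝ) := by
        push_cast
        field_simp
      rw [this]
      exact mul_le_mul_of_nonneg_right hm.le (by positivity)
    · exact (tendsto_pow_atTop two_ne_zero).comp (tendsto_add_atTop_nat 1)
    · simp only [hroot]
      exact hH'.rpow_const (.inr (by positivity))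
  have := key.pow k
  simp only [hroot, Real.rpow_inv_natCast_pow (hb _ H).1 hk0,
    Real.rpow_inv_natCast_pow ha0 hk0] at this
  exact this

/-! ### Extreme exchangeable laws -/

/-- Conditioning an exchangeable law on an event about the first `k` vertices and then deleting
these vertices gives an exchangeable law. -/
lemma map_cond_mem_exchangeableLaws {μ : Measure (SimpleGraph ℕ)} (hμ : μ ∈ exchangeableLaws)
    {A : Set (SimpleGraph ℕ)} (hA : MeasurableSet A) (k : ℕ)
    (hinv : ∀ σ : Equiv.Perm ℕ, (∀ i < k, σ i = i) →
      (fun H : SimpleGraph ℕ => H.map σ.toEmbedding) ⁻¹' A = A) (hμA : μ A ≠ 0) :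
    (ProbabilityTheory.cond μ A).map (fun H => H.comap (· + k)) ∈ exchangeableLaws := by
  have := hμ.1
  have := ProbabilityTheory.cond_isProbabilityMeasure hμA
  have hs := measurable_comap (· + k)
  have := Measure.isProbabilityMeasure_map (μ := ProbabilityTheory.cond μ A) hs.aemeasurable
  refine ⟨this, fun σ => ⟨measurable_map_perm σ, ?_⟩⟩
  -- Let `σ` act on the remaining vertices, fixing the deleted ones.
  set τ : Equiv.Perm ℕ := σ.viaEmbedding (addRightEmbedding k) with hτ
  have hτ1 : ∀ i, τ (i + k) = σ i + k := fun i =>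
    Equiv.Perm.viaEmbedding_apply σ (addRightEmbedding k) i
  have hτ2 : ∀ i < k, τ i = i := fun i hi => by
    refine Equiv.Perm.viaEmbedding_apply_of_notMem _ _ _ ?_
    rintro ⟨j, rfl⟩
    simp at hi
  have hτ3 : ∀ i, τ.symm (i + k) = σ.symm i + k := fun i => by
    rw [Equiv.symm_apply_eq, hτ1, Equiv.apply_symm_apply]
  have hcomm : ∀ H : SimpleGraph ℕ, (H.map τ.toEmbedding).comap (· + k)
      = (H.comap (· + k)).map σ.toEmbedding := fun H => by
    ext u v
    simp only [← SimpleGraph.comap_symm, SimpleGraph.comap_adj, Equiv.toEmbedding_apply, hτ3]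
  ext B hB
  have hB' := measurable_map_perm σ hB
  rw [Measure.map_apply (measurable_map_perm σ) hB, Measure.map_apply hs hB',
    Measure.map_apply hs hB, ProbabilityTheory.cond_apply hA, ProbabilityTheory.cond_apply hA,
    ← (hμ.2 τ).measure_preimage (hA.inter (hs hB)).nullMeasurableSet, Set.preimage_inter,
    hinv τ hτ2]
  congr 3
  ext H
  simp only [Set.mem_preimage, hcomm]

/-- Under an extreme exchangeable law, the presences of two disjoint copies of `F` are
independent events. -/
lemma real_containing_double_of_extreme {μ : Measure (SimpleGraph ℕ)}
    (hμ : μ ∈ Set.extremePoints ℝ≥0 exchangeableLaws) (F : Labelled) :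
    μ.real (containing F.double) = μ.real (containing F) ^ 2 := by
  have hex := hμ.1
  have := hex.1
  set k := (F.1 : ℕ) with hk
  set A := containing F with hA
  have hAm : MeasurableSet A := measurableSet_containing F
  have hs := measurable_comap (· + k)
  have hAs : (fun H : SimpleGraph ℕ => H.comap (· + k)) ⁻¹' A
      = homEvent F.2 ((· + k) ∘ Fin.val) := by
    rw [hA, containing_eq_homEvent, preimage_comap_homEvent]
  have hdouble : μ.real (containing F.double)
      = μ.real (A ∩ (fun H : SimpleGraph ℕ => H.comap (· + k)) ⁻¹' A) := by
    rw [hAs, hA, containing_eq_homEvent F, real_homEvent_inter hex]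
    rintro (i | i) (j | j) h
    · simpa [Fin.val_inj] using h
    · have := i.2; simp at h; omega
    · have := j.2; simp at h; omega
    · simpa [Fin.val_inj] using h
  rw [hdouble]
  by_cases h0 : μ A = 0
  · rw [measureReal_def, measureReal_def, h0, measure_mono_null Set.inter_subset_left h0]
    simp
  by_cases h1 : μ Aᶜ = 0
  · have hA1 : μ A = 1 := (prob_compl_eq_zero_iff hAm).1 h1
    have hsA : μ ((fun H : SimpleGraph ℕ => H.comap (· + k)) ⁻¹' A) = 1 := by
      rw [← Measure.map_apply hs hAm, map_comap_eq_self hex (add_left_injective k), hA1]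
    have h2 : μ (A ∩ (fun H : SimpleGraph ℕ => H.comap (· + k)) ⁻¹' A) = 1 := by
      rw [Set.inter_comm, measure_inter_conull h1, hsA]
    rw [measureReal_def, measureReal_def, h2, hA1]
    simp
  have hinv : ∀ σ : Equiv.Perm ℕ, (∀ i < k, σ i = i) →
      (fun H : SimpleGraph ℕ => H.map σ.toEmbedding) ⁻¹' A = A := by
    intro σ hσ
    rw [hA, containing_eq_homEvent, preimage_map_homEvent]
    congr 1
    ext i
    exact (Equiv.symm_apply_eq σ).2 (hσ i i.2).symm
  have m1 := map_cond_mem_exchangeableLaws hex hAm k hinv h0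
  have m2 := map_cond_mem_exchangeableLaws hex hAm.compl k
    (fun σ hσ => by rw [Set.preimage_compl, hinv σ hσ]) h1
  -- `μ` is a mixture of the two conditional laws, so it equals the first one.
  have hmem : μ ∈ openSegment ℝ≥0
      ((ProbabilityTheory.cond μ A).map (fun H => H.comap (· + k)))
      ((ProbabilityTheory.cond μ Aᶜ).map (fun H => H.comap (· + k))) := by
    refine ⟨(μ A).toNNReal, (μ Aᶜ).toNNReal, ENNReal.toNNReal_pos h0 (measure_ne_top _ _),
      ENNReal.toNNReal_pos h1 (measure_ne_top _ _), ?_, ?_⟩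
    · rw [← ENNReal.toNNReal_add (measure_ne_top _ _) (measure_ne_top _ _),
        measure_add_measure_compl hAm, measure_univ, ENNReal.toNNReal_one]
    · conv_rhs => rw [← map_comap_eq_self hex (add_left_injective k)]
      ext B hB
      rw [Measure.add_apply, Measure.smul_apply, Measure.smul_apply, Measure.map_apply hs hB,
        Measure.map_apply hs hB, Measure.map_apply hs hB, ENNReal.smul_def, ENNReal.smul_def,
        ENNReal.coe_toNNReal (measure_ne_top _ _), ENNReal.coe_toNNReal (measure_ne_top _ _),
        smul_eq_mul, smul_eq_mul, mul_comm, mul_comm (μ Aᶜ)]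
      exact ProbabilityTheory.cond_add_cond_compl_eq hAm μ
  have heq := hμ.2 m1 m2 hmem
  have hval : μ A = (μ A)⁻¹ * μ (A ∩ (fun H : SimpleGraph ℕ => H.comap (· + k)) ⁻¹' A) := by
    conv_lhs => rw [← heq]
    rw [Measure.map_apply hs hAm, ProbabilityTheory.cond_apply hAm]
  have hval' : μ (A ∩ (fun H : SimpleGraph ℕ => H.comap (· + k)) ⁻¹' A) = μ A * μ A :=
    calc _ = μ A * ((μ A)⁻¹ * μ (A ∩ (fun H : SimpleGraph ℕ => H.comap (· + k)) ⁻¹' A)) := by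
          rw [← mul_assoc, ENNReal.mul_inv_cancel h0 (measure_ne_top _ _), one_mul]
      _ = μ A * μ A := by rw [← hval]
  rw [measureReal_def, measureReal_def, hval', ENNReal.toReal_mul, sq]

/-- Conversely, an exchangeable law under which disjoint copies are independent is extreme: the
homomorphism densities are almost surely constant, hence they are the same constants under any
component of a mixture. -/
lemma mem_extremePoints_of_real_containing_double {μ : Measure (SimpleGraph ℕ)}
    (hμ : μ ∈ exchangeableLaws)
    (h : ∀ F : Labelled, μ.real (containing F.double) = μ.real (containing F) ^ 2) :
    μ ∈ Set.extremePoints ℝ≥0 exchangeableLaws := by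
  refine ⟨hμ, fun μ₁ h₁ μ₂ h₂ ⟨a, b, ha, hb, hab, hμab⟩ => ?_⟩
  have := hμ.1
  have := h₁.1
  have hac : μ₁ ≪ μ := by
    refine Measure.AbsolutelyContinuous.mk fun s _ hs => ?_
    rw [← hμab, Measure.add_apply, Measure.smul_apply, add_eq_zero, ENNReal.smul_def,
      smul_eq_mul, mul_eq_zero] at hs
    exact hs.1.resolve_left (by simpa using ha.ne')
  refine measure_ext_of_containing fun F => ?_
  refine tendsto_nhds_unique (tendsto_integral_homCount_div h₁ F) ?_
  have hlim := hac.ae_le (ae_tendsto_homCount_div hμ F (h F))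
  have := tendsto_integral_of_dominated_convergence (μ := μ₁)
    (F := fun n H => homCount F n H / (n : ℝ) ^ (F.1 : ℕ)) (fun _ => 1)
    (fun n => ((measurable_homCount F n).div_const _).aestronglyMeasurable)
    (integrable_const _) (fun n => ae_of_all _ fun H => ?_) hlim
  · simpa using this
  · rw [Real.norm_eq_abs, abs_of_nonneg (homCount_div_mem_unitInterval F n H).1]
    exact (homCount_div_mem_unitInterval F n H).2

/-! ### Realising limits of densities by exchangeable laws -/

/-- The values of i.i.d. uniform samples at distinct indices are jointly uniform. -/
lemma infinitePi_uniformOn_map_comp {V Ω : Type*} [Fintype V] [Fintype Ω] [Nonempty Ω]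
    [MeasurableSpace Ω] [MeasurableSingletonClass Ω] {f : V → ℕ} (hf : f.Injective) :
    (Measure.infinitePi fun _ : ℕ => ProbabilityTheory.uniformOn (Set.univ : Set Ω)).map
      (fun U => U ∘ f) = ProbabilityTheory.uniformOn Set.univ := by
  classical
  have := ProbabilityTheory.isProbabilityMeasure_uniformOn (Set.finite_univ (α := Ω))
    Set.univ_nonempty
  have h : (fun U : ℕ → Ω => U ∘ f) = fun U i => U (f i) := rfl
  have hm : Measurable fun U : ℕ → Ω => U ∘ f := by rw [h]; fun_prop
  rw [← Set.pi_univ (Set.univ : Set V), ProbabilityTheory.uniformOn_pi]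
  refine (Measure.pi_eq fun s hs => ?_).symm
  rw [Measure.map_apply hm (.univ_pi hs)]
  have hpre : (fun U : ℕ → Ω => U ∘ f) ⁻¹' Set.univ.pi s
      = Set.pi (Finset.univ.map ⟨f, hf⟩ : Finset ℕ)
        (Function.extend f s fun _ => Set.univ) := by
    ext U
    simp [Set.mem_pi, hf.extend_apply]
  rw [hpre, Measure.infinitePi_pi, Finset.prod_map]
  · simp [hf.extend_apply]
  · intro i hi
    obtain ⟨j, -, rfl⟩ := Finset.mem_map.1 hi
    simpa [hf.extend_apply] using hs j

/-- The `0`-`1` arrays on `ℕ × ℕ` in which `f` is a homomorphism from `F`. -/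
def homArrays {V : Type*} (F : SimpleGraph V) (f : V → ℕ) : Set (ℕ × ℕ → Bool) :=
  {x | ∀ i j, F.Adj i j → x (f i, f j) = true}

lemma isClopen_homArrays {V : Type*} [Finite V] (F : SimpleGraph V) (f : V → ℕ) :
    IsClopen (homArrays F f) := by
  have : homArrays F f = ⋂ i, ⋂ j, ⋂ _ : F.Adj i j, (fun x => x (f i, f j)) ⁻¹' {true} := by
    ext x; simp [homArrays]
  rw [this]
  refine isClopen_iInter_of_finite fun i => isClopen_iInter_of_finite fun j =>
    isClopen_iInter_of_finite fun _ => (isClopen_discrete _).preimage (by fun_prop)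

/-- Sampling the vertices of a finite graph `G` independently and uniformly, with replacement,
gives a random array in which `F` occurs at any given distinct places with probability
`t(F, G)`. -/
lemma exists_sampling_law (G : Labelled) : ∃ ν : ProbabilityMeasure (ℕ × ℕ → Bool),
    ∀ (F : Labelled) (f : Fin F.1 → ℕ), f.Injective →
      (ν (homArrays F.2 f) : ℝ) = homDensityReal F G := by
  classical
  have := ProbabilityTheory.isProbabilityMeasure_uniformOn (Set.finite_univ (α := Fin G.1))
    Set.univ_nonempty
  set P := Measure.infinitePi fun _ : ℕ =>
    ProbabilityTheory.uniformOn (Set.univ : Set (Fin G.1)) with hP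
  set A : (ℕ → Fin G.1) → ℕ × ℕ → Bool := fun U p => decide (G.2.Adj (U p.1) (U p.2)) with hA
  have hAm : Measurable A := by
    refine measurable_pi_lambda _ fun p => ?_
    have h1 : Measurable fun q : Fin G.1 × Fin G.1 => decide (G.2.Adj q.1 q.2) :=
      measurable_of_finite _
    have h2 : Measurable fun U : ℕ → Fin G.1 => (U p.1, U p.2) := by fun_prop
    exact h1.comp h2
  have := Measure.isProbabilityMeasure_map (μ := P) hAm.aemeasurable
  refine ⟨⟨P.map A, this⟩, fun F f hf => ?_⟩
  have hm : Measurable fun U : ℕ → Fin G.1 => U ∘ f :=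
    measurable_pi_lambda _ fun i => measurable_pi_apply (f i)
  have hpre : A ⁻¹' homArrays F.2 f = (fun U => U ∘ f) ⁻¹'
      {φ : Fin F.1 → Fin G.1 | ∀ i j, F.2.Adj i j → G.2.Adj (φ i) (φ j)} := by
    ext U; simp [hA, homArrays]
  have hcard : Nat.card (F.2 →g G.2) = Nat.card
      {φ : Fin F.1 → Fin G.1 | ∀ i j, F.2.Adj i j → G.2.Adj (φ i) (φ j)} :=
    Nat.card_congr
      { toFun := fun φ => ⟨φ, fun i j hij => φ.map_adj hij⟩
        invFun := fun φ => ⟨φ.1, fun {i j} hij => φ.2 i j hij⟩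
        left_inv := fun φ => rfl
        right_inv := fun φ => rfl }
  change ((P.map A) (homArrays F.2 f)).toReal = _
  rw [Measure.map_apply hAm (isClopen_homArrays _ _).isOpen.measurableSet, hpre,
    ← Measure.map_apply hm (Set.toFinite _).measurableSet, hP, infinitePi_uniformOn_map_comp hf,
    ProbabilityTheory.uniformOn_univ, Measure.count_apply_finite _ (Set.toFinite _),
    homDensityReal, hcard, Nat.card_coe_set_eq, Set.ncard_eq_toFinset_card _ (Set.toFinite _)]
  simp

/-- The graph on `ℕ` whose edges are the pairs `{i, j}` at which both entries of the array
are `1`. -/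
def arrayGraph (x : ℕ × ℕ → Bool) : SimpleGraph ℕ where
  Adj i j := i ≠ j ∧ x (i, j) = true ∧ x (j, i) = true
  symm := ⟨fun _ _ h => ⟨h.1.symm, h.2.2, h.2.1⟩⟩
  loopless := ⟨fun _ h => h.1 rfl⟩

lemma measurable_arrayGraph : Measurable arrayGraph := by
  rw [SimpleGraph.measurable_iff_adj]
  intro u v
  refine measurableSet_setOfPred.1 ?_
  have h : ∀ p : ℕ × ℕ, MeasurableSet {x : ℕ × ℕ → Bool | x p = true} := fun p =>
    (measurable_pi_apply (X := fun _ : ℕ × ℕ => Bool) p) (measurableSet_singleton true)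
  exact (MeasurableSet.const _).inter ((h _).inter (h _))

lemma preimage_arrayGraph_homEvent {V : Type*} (F : SimpleGraph V) {f : V → ℕ}
    (hf : f.Injective) : arrayGraph ⁻¹' homEvent F f = homArrays F f := by
  ext x
  simp only [homEvent, homArrays, arrayGraph, Set.mem_preimage, Set.mem_ofPred_eq]
  exact ⟨fun h i j hij => (h i j hij).2.1,
    fun h i j hij => ⟨fun e => hij.ne (hf e), h i j hij, h j i hij.symm⟩⟩

/-- Every limit `g` of homomorphism densities is realised by an exchangeable random graph. The
pairs of a law of arrays and a limit matching it form a closed set, and the space of laws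
is compact. -/
lemma exists_mem_exchangeableLaws {g : Unlabelled → unitInterval} (hg : g ∈ UStarBar) :
    ∃ μ ∈ exchangeableLaws, ∀ F : Labelled, μ.real (containing F) = g F.toUnlabelled := by
  set K : Set (ProbabilityMeasure (ℕ × ℕ → Bool) × (Unlabelled → unitInterval)) :=
    {p | ∀ (F : Labelled) (f : Fin F.1 → ℕ), f.Injective →
      (p.1 (homArrays F.2 f) : ℝ) = p.2 F.toUnlabelled} with hK
  have hcont : ∀ (F : Labelled) (f : Fin F.1 → ℕ),
      Continuous fun ν : ProbabilityMeasure (ℕ × ℕ → Bool) => (ν (homArrays F.2 f) : ℝ) :=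
    fun F f => NNReal.continuous_coe.comp <| continuous_iff_continuousAt.2 fun ν =>
      ProbabilityMeasure.tendsto_measure_of_isClopen_of_tendsto tendsto_id
        (isClopen_homArrays F.2 f)
  have hKc : IsClosed K := by
    simp only [hK, Set.ofPred_forall]
    refine isClosed_iInter fun F => isClosed_iInter fun f => isClosed_iInter fun _ => ?_
    exact isClosed_eq ((hcont F f).comp continuous_fst)
      (continuous_subtype_val.comp ((continuous_apply _).comp continuous_snd))
  have hsub : Set.range tau ⊆ Prod.snd '' K := by
    rintro _ ⟨G, rfl⟩
    induction G using Quotient.ind with | _ G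
    obtain ⟨ν, hν⟩ := exists_sampling_law G
    exact ⟨(ν, tau G.toUnlabelled), fun F f hf => hν F f hf, rfl⟩
  obtain ⟨⟨ν, g'⟩, hν, rfl⟩ :=
    closure_minimal hsub (isClosedMap_snd_of_compactSpace _ hKc) hg
  have := Measure.isProbabilityMeasure_map (μ := (ν : Measure (ℕ × ℕ → Bool)))
    measurable_arrayGraph.aemeasurable
  have key : ∀ (F : Labelled) (f : Fin F.1 → ℕ), f.Injective →
      ((ν : Measure (ℕ × ℕ → Bool)).map arrayGraph).real (homEvent F.2 f)
        = g' F.toUnlabelled := fun F f hf => by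
    rw [map_measureReal_apply measurable_arrayGraph (measurableSet_homEvent _ _),
      preimage_arrayGraph_homEvent _ hf]
    exact hν F f hf
  have key' : ∀ F : Labelled, ((ν : Measure (ℕ × ℕ → Bool)).map arrayGraph).real (containing F)
      = g' F.toUnlabelled := fun F => by
    rw [containing_eq_homEvent]
    exact key F _ Fin.val_injective
  exact ⟨_, mem_exchangeableLaws_of_homEvent fun F f hf => by rw [key F f hf, key' F], key'⟩

lemma card_hom_sum {V W X : Type*} (F : SimpleGraph V) (F' : SimpleGraph W)
    (G : SimpleGraph X) :
    Nat.card ((F ⊕g F') →g G) = Nat.card (F →g G) * Nat.card (F' →g G) := by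
  rw [← Nat.card_prod]
  exact Nat.card_congr
    { toFun := fun φ => (φ.comp SimpleGraph.Embedding.sumInl.toHom,
        φ.comp SimpleGraph.Embedding.sumInr.toHom)
      invFun := fun p => ⟨Sum.elim p.1 p.2, fun {i j} hij => by
        rcases i with i | i <;> rcases j with j | j <;> simp at hij
        · exact p.1.map_adj hij
        · exact p.2.map_adj hij⟩
      left_inv := fun φ => by
        ext i
        rcases i with i | i <;> rfl
      right_inv := fun p => rfl }

lemma card_hom_comap_equiv {V W X : Type*} (F : SimpleGraph V) (e : W ≃ V)
    (G : SimpleGraph X) : Nat.card (F.comap e →g G) = Nat.card (F →g G) :=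
  Nat.card_congr
    { toFun := fun φ => φ.comp (SimpleGraph.Iso.comap e F).symm.toHom
      invFun := fun φ => φ.comp (SimpleGraph.Iso.comap e F).toHom
      left_inv := fun φ => by ext i; simp
      right_inv := fun φ => by ext i; simp }

lemma homDensityReal_double (F G : Labelled) :
    homDensityReal F.double G = homDensityReal F G ^ 2 := by
  have : Nat.card (F.double.2 →g G.2) = Nat.card (F.2 →g G.2) ^ 2 := by
    rw [sq, ← card_hom_sum]
    exact card_hom_comap_equiv _ _ _
  rw [homDensityReal, homDensityReal, this, Labelled.double, div_pow, ← pow_mul, PNat.add_coe]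
  push_cast
  rw [← mul_two]

lemma apply_double_of_mem_UStarBar {g : Unlabelled → unitInterval} (hg : g ∈ UStarBar)
    (F : Labelled) : (g F.double.toUnlabelled : ℝ) = (g F.toUnlabelled : ℝ) ^ 2 := by
  have hc : IsClosed {g : Unlabelled → unitInterval |
      (g F.double.toUnlabelled : ℝ) = (g F.toUnlabelled : ℝ) ^ 2} :=
    isClosed_eq (by fun_prop) (by fun_prop)
  refine closure_minimal ?_ hc hg
  rintro _ ⟨G, rfl⟩
  induction G using Quotient.ind with | _ G
  exact homDensityReal_double F G

lemma exists_mem_extremePoints {g : Unlabelled → unitInterval} (hg : g ∈ UStarBar) :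
    ∃ μ ∈ Set.extremePoints ℝ≥0 exchangeableLaws,
      ∀ F : Labelled, μ.real (containing F) = g F.toUnlabelled := by
  obtain ⟨μ, hμ, h⟩ := exists_mem_exchangeableLaws hg
  refine ⟨μ, mem_extremePoints_of_real_containing_double hμ fun F => ?_, h⟩
  rw [h, h, apply_double_of_mem_UStarBar hg]

/-! ### The compactification and its proper limits -/

lemma ae_tendsto_homDensityReal {μ : Measure (SimpleGraph ℕ)}
    (hμ : μ ∈ Set.extremePoints ℝ≥0 exchangeableLaws) :
    ∀ᵐ H ∂μ, ∀ F : Labelled, Tendsto (fun n : ℕ+ => homDensityReal F (restrict H n)) atTop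
      (𝓝 (μ.real (containing F))) := by
  refine ae_all_iff.2 fun F => ?_
  filter_upwards [ae_tendsto_homCount_div hμ.1 F (real_containing_double_of_extreme hμ F)]
    with H hH
  simp only [homDensityReal_restrict]
  exact hH.comp tendsto_PNat_val_atTop_atTop

lemma tendsto_invOrder_restrict (H : SimpleGraph ℕ) :
    Tendsto (fun n : ℕ+ => invOrder (restrict H n).toUnlabelled) atTop (𝓝 0) := by
  rw [tendsto_subtype_rng]
  exact tendsto_inv_atTop_nhds_zero_nat.comp tendsto_PNat_val_atTop_atTop

/-- If `g` lists the probabilities `ℙ(H ⊇ F)` under an extreme law, then `H|_n` converges almost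
surely to `(g, 0)` in the compactification. -/
lemma ae_tendsto_tauPlus_restrict {μ : Measure (SimpleGraph ℕ)}
    (hμ : μ ∈ Set.extremePoints ℝ≥0 exchangeableLaws) {g : Unlabelled → unitInterval}
    (h : ∀ F : Labelled, μ.real (containing F) = g F.toUnlabelled) :
    ∀ᵐ H ∂μ, Tendsto (fun n : ℕ+ => tauPlus (restrict H n).toUnlabelled) atTop (𝓝 (g, 0)) := by
  filter_upwards [ae_tendsto_homDensityReal hμ] with H hH
  refine Tendsto.prodMk_nhds (tendsto_pi_nhds.2 fun F => ?_) (tendsto_invOrder_restrict H)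
  induction F using Quotient.ind with | _ F
  rw [tendsto_subtype_rng]
  have hF := hH F
  rw [h F] at hF
  exact hF

/-- Under an extreme law `ℙ(H ⊇ F)` depends only on the isomorphism class of `F`, being an almost
sure limit of homomorphism densities. -/
lemma exists_apply_eq_real_containing {μ : Measure (SimpleGraph ℕ)}
    (hμ : μ ∈ Set.extremePoints ℝ≥0 exchangeableLaws) :
    ∃ g : Unlabelled → unitInterval,
      ∀ F : Labelled, μ.real (containing F) = g F.toUnlabelled := by
  have := hμ.1.1
  refine ⟨fun F => ⟨μ.real (containing F.out), measureReal_nonneg, measureReal_le_one⟩,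
    fun F => ?_⟩
  obtain ⟨H, hH⟩ := (ae_tendsto_homDensityReal hμ).exists
  refine tendsto_nhds_unique (hH F) ((hH _).congr fun n => ?_)
  exact homDensityReal_congr (Quotient.mk_out F) (Setoid.refl _)

lemma mk_zero_mem_UBar {μ : Measure (SimpleGraph ℕ)}
    (hμ : μ ∈ Set.extremePoints ℝ≥0 exchangeableLaws) {g : Unlabelled → unitInterval}
    (h : ∀ F : Labelled, μ.real (containing F) = g F.toUnlabelled) : (g, 0) ∈ UBar := by
  have := hμ.1.1
  obtain ⟨H, hH⟩ := (ae_tendsto_tauPlus_restrict hμ h).exists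
  exact mem_closure_of_tendsto hH (Eventually.of_forall fun n => ⟨_, rfl⟩)

lemma invOrder_pos (G : Unlabelled) : 0 < invOrder G := by
  have : 0 < ((order G : ℕ) : ℝ)⁻¹ := by
    have := (order G).pos
    positivity
  exact this

lemma finite_setOf_order_le (N : ℕ) : {G : Unlabelled | (order G : ℕ) ≤ N}.Finite := by
  have h : {F : Labelled | (F.1 : ℕ) ≤ N}.Finite := by
    have hN : {n : ℕ+ | (n : ℕ) ≤ N}.Finite :=
      (Set.finite_Iic N).preimage PNat.coe_injective.injOn
    refine (hN.biUnion fun n _ =>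
      Set.finite_range fun A : SimpleGraph (Fin n) => (⟨n, A⟩ : Labelled)).subset ?_
    rintro ⟨n, A⟩ hn
    exact Set.mem_biUnion hn ⟨A, rfl⟩
  refine (h.image Labelled.toUnlabelled).subset fun G hG => ?_
  induction G using Quotient.ind with | _ F
  exact ⟨F, hG, rfl⟩

/-- A limit of finite graphs whose orders stay bounded is a finite graph. -/
lemma mem_range_tauPlus_of_snd_ne_zero {p : (Unlabelled → unitInterval) × unitInterval}
    (hp : p ∈ UBar) (h0 : p.2 ≠ 0) : p ∈ Set.range tauPlus := by
  have hpos : (0 : ℝ) < p.2 := unitInterval.pos_iff_ne_zero.2 h0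
  obtain ⟨N, hN⟩ := exists_nat_gt ((p.2 : ℝ) / 2)⁻¹
  have hU : IsOpen {q : (Unlabelled → unitInterval) × unitInterval | (p.2 : ℝ) / 2 < q.2} :=
    isOpen_lt continuous_const (by fun_prop)
  have hfin := (finite_setOf_order_le N).image tauPlus
  have hsub : Set.range tauPlus ∩ {q | (p.2 : ℝ) / 2 < q.2}
      ⊆ tauPlus '' {G | (order G : ℕ) ≤ N} := by
    rintro _ ⟨⟨G, rfl⟩, hG⟩
    refine ⟨G, ?_, rfl⟩
    have hG' : (p.2 : ℝ) / 2 < ((order G : ℕ) : ℝ)⁻¹ := hG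
    have : ((order G : ℕ) : ℝ) < N :=
      ((lt_inv_comm₀ (by positivity) (by exact_mod_cast (order G).pos)).1 hG').trans hN
    exact_mod_cast this.le
  have hmem : p ∈ closure (Set.range tauPlus ∩ {q | (p.2 : ℝ) / 2 < q.2}) :=
    hU.closure_inter ⟨hp, half_lt_self hpos⟩
  exact Set.image_subset_range _ _ (closure_minimal hsub hfin.isClosed hmem)

lemma mem_UInfty_iff (p : (Unlabelled → unitInterval) × unitInterval) :
    p ∈ UInfty ↔ p.1 ∈ UStarBar ∧ p.2 = 0 := by
  constructor
  · rintro ⟨h1, h2⟩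
    refine ⟨?_, by_contra fun h0 => h2 (mem_range_tauPlus_of_snd_ne_zero h1 h0)⟩
    refine map_mem_closure continuous_fst h1 ?_
    rintro _ ⟨G, rfl⟩
    exact ⟨G, rfl⟩
  · rintro ⟨h1, h2⟩
    obtain ⟨μ, hμ, h⟩ := exists_mem_extremePoints h1
    refine ⟨?_, ?_⟩
    · rw [show p = (p.1, 0) from Prod.ext rfl h2]
      exact mk_zero_mem_UBar hμ h
    · rintro ⟨G, rfl⟩
      exact (invOrder_pos G).ne' h2

/-- The projection `𝓤_∞ → [0, 1]^𝓤` is a homeomorphism onto the closure of `τ(𝓤)`, with inverse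
`g ↦ (g, 0)`. -/
def homeoUStarBar : UInfty ≃ₜ UStarBar where
  toFun Γ := ⟨Γ.1.1, ((mem_UInfty_iff _).1 Γ.2).1⟩
  invFun g := ⟨(g.1, 0), (mem_UInfty_iff _).2 ⟨g.2, rfl⟩⟩
  left_inv Γ := Subtype.ext (Prod.ext rfl ((mem_UInfty_iff _).1 Γ.2).2.symm)
  right_inv _ := rfl
  continuous_toFun := by fun_prop
  continuous_invFun := by fun_prop

end GraphLimits

open GraphLimits in
theorem corollary5p4 :
    ∃ e : GraphLimits.UInfty ≃ Set.extremePoints ℝ≥0 GraphLimits.exchangeableLaws,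
      (∀ (Γ : GraphLimits.UInfty) (μ : Set.extremePoints ℝ≥0 GraphLimits.exchangeableLaws),
        e Γ = μ ↔
          ∀ F : GraphLimits.Labelled,
            GraphLimits.tExt F.toUnlabelled Γ.1 = μ.1.real (GraphLimits.containing F)) ∧
      (∀ Γ : GraphLimits.UInfty, ∀ᵐ H ∂(e Γ).1,
        Tendsto (fun n : ℕ+ => GraphLimits.tauPlus (GraphLimits.restrict H n).toUnlabelled)
          atTop (𝓝 Γ.1)) ∧
      ∃ p : GraphLimits.UInfty ≃ₜ GraphLimits.UStarBar,
        ∀ Γ : GraphLimits.UInfty, (p Γ).1 = Γ.1.1 := by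
  have hex : ∀ Γ : UInfty, ∃ μ : Set.extremePoints ℝ≥0 exchangeableLaws,
      ∀ F : Labelled, μ.1.real (containing F) = Γ.1.1 F.toUnlabelled := fun Γ => by
    obtain ⟨μ, hμ, h⟩ := exists_mem_extremePoints ((mem_UInfty_iff _).1 Γ.2).1
    exact ⟨⟨μ, hμ⟩, h⟩
  choose e he using hex
  have huniq : ∀ (Γ : UInfty) (μ : Set.extremePoints ℝ≥0 exchangeableLaws),
      (∀ F : Labelled, tExt F.toUnlabelled Γ.1 = μ.1.real (containing F)) → e Γ = μ := by
    intro Γ μ h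
    have := (e Γ).2.1.1
    have := μ.2.1.1
    exact Subtype.ext (measure_ext_of_containing fun F => (he Γ F).trans (h F))
  have hinj : Function.Injective e := by
    intro Γ Γ' h
    refine Subtype.ext (Prod.ext (funext fun F => ?_) ?_)
    · induction F using Quotient.ind with | _ F
      exact Subtype.ext ((he Γ F).symm.trans (h ▸ he Γ' F))
    · rw [((mem_UInfty_iff _).1 Γ.2).2, ((mem_UInfty_iff _).1 Γ'.2).2]
  have hsurj : Function.Surjective e := by
    intro μ
    obtain ⟨g, hg⟩ := exists_apply_eq_real_containing μ.2
    have hmem : (g, (0 : unitInterval)) ∈ UInfty := by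
      refine ⟨mk_zero_mem_UBar μ.2 hg, ?_⟩
      rintro ⟨G, hG⟩
      exact (invOrder_pos G).ne' (congrArg Prod.snd hG)
    exact ⟨⟨_, hmem⟩, huniq _ _ fun F => (hg F).symm⟩
  refine ⟨Equiv.ofBijective e ⟨hinj, hsurj⟩, fun Γ μ => ⟨?_, huniq Γ μ⟩, fun Γ => ?_,
    homeoUStarBar, fun _ => rfl⟩
  · rintro rfl F
    exact (he Γ F).symm
  · have h : Γ.1 = (Γ.1.1, 0) := Prod.ext rfl ((mem_UInfty_iff _).1 Γ.2).2
    rw [h]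
    exact ae_tendsto_tauPlus_restrict (e Γ).2 (he Γ)
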